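/- For $n\ge 0$ let $S_n(T)$ be the set of permutations of length $n$ that avoid, in the sense of classical pattern avoidance, every pattern in $T=\{1342,2143,2413\}$ (that is, no subsequence of the one-line notation is order-isomorphic to a pattern in $T$), and let $F_T(x)=\sum_{n\ge 0}|S_n(T)|\,x^n$. Then, as formal power series, $$F_T(x)=\frac{1-3x+x^2-\sqrt{(1-7x+13x^2-8x^3)(1-3x+x^2)}}{2x(1-x)(1-2x)},$$ where the square root denotes the formal power series with constant term $1$ whose square is the radicand. -/

import Mathlib

open PowerSeries

/-- The permutation `π` of `{0, …, n-1}` (one-line notation `π 0, π 1, …, π (n-1)`) contains the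
pattern `τ` (one-line notation `τ 0, …, τ (k-1)`, with distinct letters): some subsequence of `π`
of length `k` is order-isomorphic to `τ`. -/
def ContainsPattern {n k : ℕ} (π : Equiv.Perm (Fin n)) (τ : Fin k → ℕ) : Prop :=
  ∃ p : Fin k → Fin n, StrictMono p ∧ ∀ a b : Fin k, π (p a) < π (p b) ↔ τ a < τ b

/-- `S_n(T)`: the permutations of length `n` that contain no pattern of `T`. -/
def avoiders {k : ℕ} (T : Set (Fin k → ℕ)) (n : ℕ) : Set (Equiv.Perm (Fin n)) :=
  {π | ∀ τ ∈ T, ¬ ContainsPattern π τ}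

/-- `F_T(x) = ∑_{n ≥ 0} |S_n(T)| x^n`, as a formal power series. -/
noncomputable def avoiderGF {k : ℕ} (T : Set (Fin k → ℕ)) : ℚ⟦X⟧ :=
  PowerSeries.mk fun n => ((avoiders T n).ncard : ℚ)

/-!
Split an avoider at its maximum `m`, as `L m R`. Avoiding `1342` makes the letters of `L` that
exceed all of `R` come before the others, so `L = B S` with `B` above `R` and every letter of `S`
below some letter of `R`; avoiding `2143` makes `S` increasing. Avoiding `2413` makes the letters
of `R` that exceed some letter of `S` come before the others, so `R = U D`, and `1342` forces
`S < U` and forbids `231` in `U`. Hence every avoider is `B S m U D` with values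
`D < S < U < B < m`, where `D` and `B` are arbitrary avoiders and `S` and `U` are either both
empty, or both non-empty with `S` increasing and `U` avoiding `231`. Conversely all such words are
avoiders, and `S` and `U` being empty together makes the blocks unique.

With `G` the generating function of the avoiders that also avoid `231`, this reads
`F = 1 + x F² (1 + x / (1 - x) (G - 1))`. The same split of the latter words has `B` and `D`
empty, and `S` is any word of the same class if `U` is empty, so
`G = 1 + x (G + (G - 1) / (1 - x))` is rational and `F` satisfies a quadratic equation.
-/

open scoped List

section PatternAvoidance

variable {α β : Type*} {k : ℕ}

/-- The words that avoid, in the sense of classical pattern avoidance, every pattern of `T`: no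
subsequence is order-isomorphic to a member of `T`. -/
def avoidingWords (α : Type*) [LT α] (T : Set (Fin k → ℕ)) : Set (List α) :=
  {l | ∀ τ ∈ T, ∀ w : Fin k → α, List.ofFn w <+ l → ¬ ∀ i j, w i < w j ↔ τ i < τ j}

theorem mem_avoidingWords_of_sublist [LT α] {T : Set (Fin k → ℕ)} {l l' : List α} (h : l' <+ l)
    (hl : l ∈ avoidingWords α T) : l' ∈ avoidingWords α T :=
  fun τ hτ w hw => hl τ hτ w (hw.trans h)

theorem nil_mem_avoidingWords [LT α] (T : Set (Fin (k + 1) → ℕ)) : [] ∈ avoidingWords α T :=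
  fun _ _ w hw => by simp at hw

theorem map_mem_avoidingWords_iff [Preorder α] [Preorder β] (f : α ↪o β) {T : Set (Fin k → ℕ)}
    {l : List α} : l.map f ∈ avoidingWords β T ↔ l ∈ avoidingWords α T := by
  refine forall₂_congr fun τ _ => ⟨fun h w hw hτ => ?_, fun h w hw hτ => ?_⟩
  · exact h (f ∘ w) (by simpa only [List.map_ofFn] using hw.map f)
      fun i j => f.lt_iff_lt.trans (hτ i j)
  · obtain ⟨t, ht, hwt⟩ := List.sublist_map_iff.1 hw
    obtain rfl : k = t.length := by simpa using congrArg List.length hwt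
    obtain rfl : w = f ∘ t.get := List.ofFn_injective (by simpa [← List.map_ofFn] using hwt)
    exact h t.get (by simpa using ht) fun i j => f.lt_iff_lt.symm.trans (hτ i j)

theorem lt_iff_lt_of_strictMono_comp {ι : Type*} [LinearOrder ι] [Preorder α] [Preorder β]
    {σ : ι → ι} {v : ι → α} {w : ι → β} (hσ : Function.Surjective σ) (hv : StrictMono (v ∘ σ))
    (hw : StrictMono (w ∘ σ)) (i j : ι) : v i < v j ↔ w i < w j := by
  obtain ⟨i, rfl⟩ := hσ i
  obtain ⟨j, rfl⟩ := hσ j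
  exact hv.lt_iff_lt.trans hw.lt_iff_lt.symm

theorem mem_avoidingWords_231 [Preorder α] {l : List α} :
    l ∈ avoidingWords α {![2, 3, 1]} ↔ ∀ a b c, [a, b, c] <+ l → ¬ (c < a ∧ a < b) := by
  simp only [avoidingWords, Set.mem_ofPred_eq, Set.mem_singleton_iff, forall_eq]
  refine ⟨fun h a b c hs hc => h ![a, b, c] hs ?_, fun h w hw hτ => h (w 0) (w 1) (w 2) ?_ ?_⟩
  · refine lt_iff_lt_of_strictMono_comp (σ := ![2, 0, 1]) (by decide) ?_ ?_ <;>
    simp [Fin.strictMono_iff_lt_succ, Fin.forall_fin_succ, hc]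
  · simpa using hw
  · exact ⟨(hτ 2 0).2 (by simp), (hτ 0 1).2 (by simp)⟩

/-- The set `T = {1342, 2143, 2413}`. -/
def forbiddenPatterns : Set (Fin 4 → ℕ) := {![1, 3, 4, 2], ![2, 1, 4, 3], ![2, 4, 1, 3]}

theorem mem_avoidingWords_forbiddenPatterns [Preorder α] {l : List α} :
    l ∈ avoidingWords α forbiddenPatterns ↔ ∀ a b c d, [a, b, c, d] <+ l →
      ¬ (a < d ∧ d < b ∧ b < c) ∧ ¬ (b < a ∧ a < d ∧ d < c) ∧ ¬ (c < a ∧ a < d ∧ d < b) := by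
  simp only [avoidingWords, forbiddenPatterns, Set.mem_ofPred_eq, Set.mem_insert_iff,
    Set.mem_singleton_iff, forall_eq_or_imp, forall_eq]
  constructor
  · rintro ⟨h1342, h2143, h2413⟩ a b c d hs
    refine ⟨fun h => h1342 ![a, b, c, d] hs
        (lt_iff_lt_of_strictMono_comp (σ := ![0, 3, 1, 2]) (by decide) ?_ ?_),
      fun h => h2143 ![a, b, c, d] hs
        (lt_iff_lt_of_strictMono_comp (σ := ![1, 0, 3, 2]) (by decide) ?_ ?_),
      fun h => h2413 ![a, b, c, d] hs
        (lt_iff_lt_of_strictMono_comp (σ := ![2, 0, 3, 1]) (by decide) ?_ ?_)⟩ <;>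
    simp [Fin.strictMono_iff_lt_succ, Fin.forall_fin_succ, h]
  · intro h
    refine ⟨fun w hw hτ => (h _ _ _ _ (by simpa using hw)).1 ?_,
      fun w hw hτ => (h _ _ _ _ (by simpa using hw)).2.1 ?_,
      fun w hw hτ => (h _ _ _ _ (by simpa using hw)).2.2 ?_⟩ <;>
    simp [hτ]

end PatternAvoidance

section OneLine

variable {α : Type*} {k n : ℕ}

theorem ofFn_sublist_ofFn_iff {w : Fin k → α} {f : Fin n → α} :
    List.ofFn w <+ List.ofFn f ↔ ∃ p : Fin k → Fin n, StrictMono p ∧ f ∘ p = w := by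
  rw [List.sublist_iff_exists_fin_orderEmbedding_get_eq]
  constructor
  · rintro ⟨g, hg⟩
    refine ⟨Fin.cast (by simp) ∘ g ∘ Fin.cast (by simp), fun i j hij => ?_, funext fun i => ?_⟩
    · exact Fin.lt_def.2 (Fin.lt_def.1 (g.strictMono hij))
    · simpa [Fin.cast] using (hg (i.cast (by simp))).symm
  · rintro ⟨p, hp, rfl⟩
    refine ⟨OrderEmbedding.ofStrictMono (Fin.cast (by simp) ∘ p ∘ Fin.cast (by simp))
      fun i j hij => ?_, fun i => ?_⟩
    · exact Fin.lt_def.2 (Fin.lt_def.1 (hp hij))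
    · simp only [List.get_ofFn]
      rfl

/-- The one-line notation `π 0, π 1, …, π (n - 1)` of a permutation. -/
def oneLine (π : Equiv.Perm (Fin n)) : List ℕ := List.ofFn fun i => (π i : ℕ)

theorem oneLine_injective : Function.Injective (oneLine (n := n)) := fun _ _ h =>
  Equiv.ext fun i => Fin.ext (congrFun (List.ofFn_injective h) i)

theorem oneLine_mem_avoidingWords_iff {T : Set (Fin k → ℕ)} {π : Equiv.Perm (Fin n)} :
    oneLine π ∈ avoidingWords ℕ T ↔ π ∈ avoiders T n := by
  refine forall₂_congr fun τ _ => ?_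
  simp only [oneLine, ofFn_sublist_ofFn_iff, ContainsPattern, forall_exists_index, and_imp,
    not_exists, not_and]
  constructor
  · intro h p hp
    exact h _ p hp rfl
  · rintro h _ p hp rfl
    exact h p hp

theorem range_oneLine : Set.range (oneLine (n := n)) = {l | l ~ List.range n} := by
  have h_range : List.ofFn (fun i : Fin n => (i : ℕ)) = List.range n :=
    List.ext_getElem (by simp) (by simp)
  refine Set.eq_of_subset_of_subset ?_ fun l hl => ?_
  · rintro _ ⟨π, rfl⟩
    exact h_range ▸ π.ofFn_comp_perm fun i => (i : ℕ)
  · obtain rfl : n = l.length := by simpa using hl.length_eq.symm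
    have hlt (i : Fin l.length) : l.get i < l.length := by simpa using hl.mem_iff.1 (l.get_mem i)
    have hinj : Function.Injective fun i => (⟨l.get i, hlt i⟩ : Fin l.length) := fun i j hij =>
      List.nodup_iff_injective_get.1 (hl.nodup_iff.2 List.nodup_range) (congrArg Fin.val hij)
    exact ⟨Equiv.ofBijective _ (Finite.injective_iff_bijective.1 hinj), by simp [oneLine]⟩

end OneLine

section SymbolicMethod

open Finset.HasAntidiagonal (antidiagonal mem_antidiagonal)

variable {k : ℕ}

/-- The orderings of the `n` letters `s, …, s + n - 1` that belong to the class `C`. -/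
def words (C : Set (List ℕ)) (s n : ℕ) : Set (List ℕ) := {l ∈ C | l ~ List.range' s n}

/-- Membership in the class `C` does not change when all letters are raised by the same amount, so
that `C` has as many orderings of any `n` consecutive letters as of `0, …, n - 1`. -/
def TranslationInvariant (C : Set (List ℕ)) : Prop :=
  ∀ (s : ℕ) (l : List ℕ), l.map (s + ·) ∈ C ↔ l ∈ C

/-- The ordinary generating function of the orderings of `0, …, n - 1` in the class `C`. -/
noncomputable def wordGF (C : Set (List ℕ)) : ℚ⟦X⟧ :=
  PowerSeries.mk fun n => ((words C 0 n).ncard : ℚ)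

/-- The blocks `b 0, …, b (k - 1)` occupy successive value ranges: every letter of an earlier block
is smaller than every letter of a later one. -/
def Stacked {α : Type*} [LT α] (b : Fin k → List α) : Prop :=
  ∀ i j, i < j → ∀ x ∈ b i, ∀ y ∈ b j, x < y

/-- The stacked blocks that belong either to the classes `P` or to the classes `Q`. -/
def stackedBlocks {α : Type*} [LT α] (P Q : Fin k → Set (List α)) : Set (Fin k → List α) :=
  {b | Stacked b ∧ ((∀ i, b i ∈ P i) ∨ ∀ i, b i ∈ Q i)}

/-- The ways to write an ordering of `s, …, s + n - 1` as stacked blocks, the `i`-th one from the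
class `C i`. -/
def stackings (C : Fin k → Set (List ℕ)) (s n : ℕ) : Set (Fin k → List ℕ) :=
  {b | (∀ i, b i ∈ C i) ∧ Stacked b ∧ (List.ofFn b).flatten ~ List.range' s n}

theorem finite_words (C : Set (List ℕ)) (s n : ℕ) : (words C s n).Finite :=
  (List.finite_toSet (List.range' s n).permutations).subset fun _ hl =>
    List.mem_permutations.2 hl.2

theorem words_zero {C : Set (List ℕ)} (hC : [] ∈ C) (s : ℕ) : words C s 0 = {[]} := by
  ext l
  simp only [words, List.range'_zero, List.perm_nil, Set.mem_ofPred_eq, Set.mem_singleton_iff,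
    and_iff_right_iff_imp]
  rintro rfl
  exact hC

theorem words_eq_image_map_add {C : Set (List ℕ)} (hC : TranslationInvariant C) (s n : ℕ) :
    words C s n = List.map (s + ·) '' words C 0 n := by
  have h_range : List.range' s n = (List.range' 0 n).map (s + ·) := by simp [List.map_add_range']
  refine Set.Subset.antisymm ?_ ?_
  · rintro l ⟨hl, hperm⟩
    obtain ⟨t, rfl⟩ : l ∈ Set.range (List.map (s + ·)) := by
      rw [Set.range_list_map]
      intro x hx
      exact ⟨x - s, Nat.add_sub_of_le (List.mem_range'_1.1 (hperm.mem_iff.1 hx)).1⟩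
    refine ⟨t, ⟨(hC s t).1 hl, ?_⟩, rfl⟩
    rwa [h_range, List.map_perm_map_iff (add_right_injective s)] at hperm
  · rintro _ ⟨t, ⟨ht, hperm⟩, rfl⟩
    exact ⟨(hC s t).2 ht, h_range ▸ hperm.map (s + ·)⟩

theorem ncard_words {C : Set (List ℕ)} (hC : TranslationInvariant C) (s n : ℕ) :
    (words C s n).ncard = (words C 0 n).ncard := by
  rw [words_eq_image_map_add hC, Set.ncard_image_of_injective _
    (List.map_injective_iff.2 (add_right_injective s))]

theorem stacked_cons_iff {α : Type*} [LT α] {l : List α} {b : Fin k → List α} :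
    Stacked (Fin.cons l b : Fin (k + 1) → List α) ↔
      (∀ x ∈ l, ∀ y ∈ (List.ofFn b).flatten, x < y) ∧ Stacked b := by
  simp only [Stacked, Fin.forall_fin_succ, Fin.cons_zero, Fin.cons_succ,
    IsEmpty.forall_iff, Fin.succ_pos, forall_true_left, true_and, Fin.not_lt_zero,
    Fin.succ_lt_succ_iff, List.mem_flatten, List.mem_ofFn]
  grind

theorem append_perm_range'_iff {s n : ℕ} {l₁ l₂ : List ℕ} :
    (l₁ ++ l₂ ~ List.range' s n ∧ ∀ x ∈ l₁, ∀ y ∈ l₂, x < y) ↔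
      ∃ p ∈ antidiagonal n, l₁ ~ List.range' s p.1 ∧ l₂ ~ List.range' (s + p.1) p.2 := by
  constructor
  · rintro ⟨hperm, hlt⟩
    have hlen : l₁.length + l₂.length = n := by simpa using hperm.length_eq
    have h₁ := l₁.mergeSort_perm (· ≤ ·)
    have h₂ := l₂.mergeSort_perm (· ≤ ·)
    have h_sorted : (l₁.mergeSort (· ≤ ·) ++ l₂.mergeSort (· ≤ ·)).Pairwise (· ≤ ·) :=
      List.pairwise_append.2 ⟨List.pairwise_mergeSort' _ _, List.pairwise_mergeSort' _ _,
        fun x hx y hy => (hlt x (h₁.mem_iff.1 hx) y (h₂.mem_iff.1 hy)).le⟩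
    have h_eq := ((h₁.append h₂).trans hperm).eq_of_pairwise' h_sorted
      (List.pairwise_le_range' _)
    rw [← hlen, ← List.range'_append_1] at h_eq
    obtain ⟨e₁, e₂⟩ := List.append_inj h_eq (by simp)
    exact ⟨(l₁.length, l₂.length), by simpa using hlen, e₁ ▸ h₁.symm, e₂ ▸ h₂.symm⟩
  · rintro ⟨⟨i, j⟩, hij, h₁, h₂⟩
    obtain rfl := mem_antidiagonal.1 hij
    refine ⟨List.range'_append_1 ▸ h₁.append h₂, fun x hx y hy => ?_⟩
    exact (List.mem_range'_1.1 (h₁.mem_iff.1 hx)).2.trans_le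
      (List.mem_range'_1.1 (h₂.mem_iff.1 hy)).1

theorem cons_mem_stackings_iff {C : Fin (k + 1) → Set (List ℕ)} {s n : ℕ} {l : List ℕ}
    {b : Fin k → List ℕ} :
    (Fin.cons l b : Fin (k + 1) → List ℕ) ∈ stackings C s n ↔ ∃ p ∈ antidiagonal n,
      l ∈ words (C 0) s p.1 ∧ b ∈ stackings (Fin.tail C) (s + p.1) p.2 := by
  have h_perm := append_perm_range'_iff (s := s) (n := n) (l₁ := l) (l₂ := (List.ofFn b).flatten)
  simp only [stackings, words, Set.mem_ofPred_eq, Fin.forall_fin_succ, stacked_cons_iff,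
    List.ofFn_succ, List.flatten_cons, Fin.cons_zero, Fin.cons_succ, Fin.tail]
  grind

theorem stackings_succ (C : Fin (k + 1) → Set (List ℕ)) (s n : ℕ) :
    stackings C s n = ⋃ p ∈ (antidiagonal n : Set (ℕ × ℕ)),
      Fin.consEquiv (fun _ => List ℕ) ''
        words (C 0) s p.1 ×ˢ stackings (Fin.tail C) (s + p.1) p.2 := by
  ext b
  induction b using Fin.consCases with | cons l b
  rw [cons_mem_stackings_iff]
  simp only [Fin.consEquiv, Set.mem_iUnion, SetLike.mem_coe, exists_prop]
  simp

theorem finite_stackings (C : Fin k → Set (List ℕ)) (s n : ℕ) : (stackings C s n).Finite := by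
  induction k generalizing s n with
  | zero => exact Set.toFinite _
  | succ k ih =>
    rw [stackings_succ]
    exact (antidiagonal n).finite_toSet.biUnion
      fun p _ => ((finite_words _ _ _).prod (ih _ _ _)).image _

theorem ncard_stackings {C : Fin k → Set (List ℕ)} (hC : ∀ i, TranslationInvariant (C i))
    (s n : ℕ) : ((stackings C s n).ncard : ℚ) = coeff n (∏ i, wordGF (C i)) := by
  induction k generalizing s n with
  | zero => cases n <;> simp [stackings, Stacked, coeff_one]
  | succ k ih =>
    have h_disjoint : (antidiagonal n : Set (ℕ × ℕ)).PairwiseDisjoint fun p =>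
        Fin.consEquiv (fun _ => List ℕ) ''
          words (C 0) s p.1 ×ˢ stackings (Fin.tail C) (s + p.1) p.2 := by
      intro p hp q hq hpq
      refine Set.disjoint_left.2 ?_
      rintro _ ⟨⟨l, b⟩, ⟨hl, -⟩, rfl⟩ ⟨⟨l', b'⟩, ⟨hl', -⟩, h⟩
      obtain rfl : l' = l := congrFun h 0
      have h_fst : p.1 = q.1 := by simpa using hl.2.length_eq.symm.trans hl'.2.length_eq
      have h_snd : p.1 + p.2 = q.1 + q.2 :=
        (mem_antidiagonal.1 hp).trans (mem_antidiagonal.1 hq).symm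
      exact hpq (Prod.ext h_fst (by lia))
    rw [stackings_succ, (antidiagonal n).finite_toSet.ncard_biUnion
      (fun p _ => ((finite_words _ _ _).prod (finite_stackings _ _ _)).image _) h_disjoint,
      finsum_mem_coe_finset, Fin.prod_univ_succ, coeff_mul, Nat.cast_sum]
    refine Finset.sum_congr rfl fun p _ => ?_
    rw [Set.ncard_image_of_injective _ (Equiv.injective _), Set.ncard_prod, Nat.cast_mul,
      ncard_words (hC 0), ih (C := Fin.tail C) fun i => hC i.succ, wordGF, coeff_mk]
    rfl

theorem wordGF_eq_one_add_X_mul {C : Set (List ℕ)} {P Q : Fin k → Set (List ℕ)}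
    {assemble : ℕ → (Fin k → List ℕ) → List ℕ} (hC : [] ∈ C)
    (hP : ∀ i, TranslationInvariant (P i)) (hQ : ∀ i, TranslationInvariant (Q i))
    (hPQ : ∃ i, Disjoint (P i) (Q i))
    (h : ∀ n, Set.BijOn (assemble n) (stackings P 0 n ∪ stackings Q 0 n) (words C 0 (n + 1))) :
    wordGF C = 1 + X * (∏ i, wordGF (P i) + ∏ i, wordGF (Q i)) := by
  ext n
  cases n with
  | zero => simp [wordGF, words_zero hC]
  | succ n =>
    have h_disjoint : Disjoint (stackings P 0 n) (stackings Q 0 n) :=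
      Set.disjoint_left.2 fun b hb hb' => hPQ.elim fun i hi =>
        Set.disjoint_left.1 hi (hb.1 i) (hb'.1 i)
    rw [map_add, coeff_succ_X_mul, coeff_one, if_neg n.succ_ne_zero, zero_add, map_add,
      ← ncard_stackings hP 0, ← ncard_stackings hQ 0, wordGF, coeff_mk, ← (h n).image_eq,
      (h n).injOn.ncard_image, Set.ncard_union_eq h_disjoint (finite_stackings _ _ _)
      (finite_stackings _ _ _), Nat.cast_add]

theorem wordGF_singleton_nil : wordGF {[]} = 1 := by
  ext n
  cases n with
  | zero => simp [wordGF, words_zero]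
  | succ n =>
    have h_empty : words {[]} 0 (n + 1) = ∅ := by simp [words, Set.eq_empty_iff_forall_notMem]
    simp [wordGF, h_empty, coeff_one]

theorem wordGF_diff_singleton_nil {C : Set (List ℕ)} (hC : [] ∈ C) :
    wordGF (C \ {[]}) = wordGF C - 1 := by
  ext n
  cases n with
  | zero =>
    have h_empty : words (C \ {[]}) 0 0 = ∅ := by simp [words, Set.eq_empty_iff_forall_notMem]
    simp [wordGF, h_empty, words_zero hC]
  | succ n =>
    have h_eq : words (C \ {[]}) 0 (n + 1) = words C 0 (n + 1) := by
      ext l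
      simp only [words, Set.mem_ofPred_eq, Set.mem_sdiff, Set.mem_singleton_iff]
      grind [List.nil_perm]
    simp [wordGF, h_eq, coeff_one]

/-- The strictly increasing words. -/
def increasingWords (α : Type*) [LT α] : Set (List α) := {l | l.Pairwise (· < ·)}

theorem wordGF_increasingWords : wordGF (increasingWords ℕ) = PowerSeries.mk 1 := by
  ext n
  have h_eq : words (increasingWords ℕ) 0 n = {List.range' 0 n} := by
    ext l
    refine ⟨fun h => ?_, ?_⟩
    · exact h.2.eq_of_pairwise' (r := (· ≤ ·)) (h.1.imp le_of_lt) (List.pairwise_le_range' _)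
    · rintro rfl
      exact ⟨List.pairwise_lt_range' _, .rfl⟩
  simp [wordGF, h_eq]

theorem translationInvariant_singleton_nil : TranslationInvariant {[]} :=
  fun _ _ => List.map_eq_nil_iff

theorem TranslationInvariant.inter {C D : Set (List ℕ)} (hC : TranslationInvariant C)
    (hD : TranslationInvariant D) : TranslationInvariant (C ∩ D) :=
  fun s l => and_congr (hC s l) (hD s l)

theorem TranslationInvariant.diff {C D : Set (List ℕ)} (hC : TranslationInvariant C)
    (hD : TranslationInvariant D) : TranslationInvariant (C \ D) :=
  fun s l => and_congr (hC s l) (not_congr (hD s l))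

theorem translationInvariant_increasingWords : TranslationInvariant (increasingWords ℕ) :=
  fun s l => by simp [increasingWords, List.pairwise_map]

theorem translationInvariant_avoidingWords (T : Set (Fin k → ℕ)) :
    TranslationInvariant (avoidingWords ℕ T) :=
  fun s _ => map_mem_avoidingWords_iff (OrderEmbedding.addLeft s)

theorem avoiderGF_eq_wordGF (T : Set (Fin k → ℕ)) : avoiderGF T = wordGF (avoidingWords ℕ T) := by
  have h_image (n : ℕ) : oneLine '' avoiders T n = words (avoidingWords ℕ T) 0 n := by
    rw [show avoiders T n = oneLine ⁻¹' avoidingWords ℕ T from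
      Set.ext fun π => oneLine_mem_avoidingWords_iff.symm, Set.image_preimage_eq_inter_range,
      range_oneLine, List.range_eq_range']
    rfl
  ext n
  rw [avoiderGF, coeff_mk, wordGF, coeff_mk, ← h_image, oneLine_injective.injOn.ncard_image]

end SymbolicMethod

section Closure

variable {α : Type*} {k : ℕ} {w : Fin (k + 1) → α} {l l₁ l₂ : List α} {m x : α}
  {T : Set (Fin (k + 1) → ℕ)}

theorem ofFn_sublist_append (h : List.ofFn w <+ l₁ ++ l₂) :
    List.ofFn w <+ l₁ ∨ List.ofFn w <+ l₂ ∨ w 0 ∈ l₁ ∧ w (Fin.last k) ∈ l₂ := by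
  obtain ⟨v₁, v₂, hw, h₁, h₂⟩ := List.sublist_append_iff.1 h
  rcases v₁ with _ | ⟨a, v₁⟩
  · exact .inr (.inl (hw ▸ h₂))
  rcases v₂.eq_nil_or_concat' with rfl | ⟨v₂, c, rfl⟩
  · exact .inl (by rwa [hw, List.append_nil])
  obtain rfl : w 0 = a := by simpa using congrArg List.head? hw
  obtain rfl : w (Fin.last k) = c := by
    rw [List.ofFn_succ_last, ← List.append_assoc] at hw
    simpa using (List.append_inj' hw rfl).2
  exact .inr (.inr ⟨h₁.subset (by simp), h₂.subset (by simp)⟩)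

variable [Preorder α]

theorem append_mem_avoidingWords
    (hT : ∀ τ ∈ T, τ 0 < τ (Fin.last k) ∧ ∃ j, τ (Fin.last k) < τ j)
    (h₁ : l₁ ∈ avoidingWords α T) (h₂ : l₂ ∈ avoidingWords α T) (hm : ∀ x ∈ l₁ ++ l₂, x ≤ m)
    (h : ∀ x ∈ l₁, ∀ y ∈ l₂, y = m ∨ y < x) : l₁ ++ l₂ ∈ avoidingWords α T := by
  intro τ hτ w hw hwτ
  obtain ⟨h_first, j, h_last⟩ := hT τ hτ
  -- An occurrence across the gap would end in its maximum or below its first letter, unlike `τ`.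
  rcases ofFn_sublist_append hw with hw₁ | hw₂ | ⟨hw₁, hw₂⟩
  · exact h₁ τ hτ w hw₁ hwτ
  · exact h₂ τ hτ w hw₂ hwτ
  · rcases h _ hw₁ _ hw₂ with h_max | h_lt
    · exact (hm _ (hw.subset (List.mem_ofFn.2 ⟨j, rfl⟩))).not_gt (h_max ▸ (hwτ _ _).2 h_last)
    · exact h_lt.not_gt ((hwτ _ _).2 h_first)

theorem concat_mem_avoidingWords (hT : ∀ τ ∈ T, ∃ j, τ (Fin.last k) < τ j)
    (hl : l ∈ avoidingWords α T) (hm : ∀ x ∈ l, x < m) : l ++ [m] ∈ avoidingWords α T := by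
  intro τ hτ w hw hwτ
  obtain ⟨j, hj⟩ := hT τ hτ
  have h_le : w j ≤ m := by
    have h_mem := hw.subset (List.mem_ofFn.2 ⟨j, rfl⟩)
    grind
  have h_last : w (Fin.last k) ∉ [m] := fun h_mem =>
    h_le.not_gt (List.mem_singleton.1 h_mem ▸ (hwτ _ _).2 hj)
  rcases ofFn_sublist_append hw with hw₁ | hw₂ | hw₂
  · exact hl τ hτ w hw₁ hwτ
  · exact h_last (hw₂.subset (List.mem_ofFn.2 ⟨_, rfl⟩))
  · exact h_last hw₂.2

theorem cons_mem_avoidingWords (hT : ∀ τ ∈ T, ∃ j, τ 0 < τ j)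
    (hl : l ∈ avoidingWords α T) (hm : ∀ x ∈ l, x < m) : m :: l ∈ avoidingWords α T := by
  intro τ hτ w hw hwτ
  obtain ⟨j, hj⟩ := hT τ hτ
  have h_le : w j ≤ m := by
    have h_mem := hw.subset (List.mem_ofFn.2 ⟨j, rfl⟩)
    grind
  rcases List.sublist_cons_iff.1 hw with hw | ⟨v, h_eq, -⟩
  · exact hl τ hτ w hw hwτ
  · obtain rfl : w 0 = m := by simpa using congrArg List.head? h_eq
    exact h_le.not_gt ((hwτ _ _).2 hj)

/-- The words that avoid `231` as well as `T`, in other words `231` and `2143`, since `1342` and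
`2413` contain `231`. -/
def avoidingWords231 (α : Type*) [LT α] : Set (List α) :=
  avoidingWords α forbiddenPatterns ∩ avoidingWords α {![2, 3, 1]}

theorem mem_avoidingWords231_of_sublist (h : l₁ <+ l₂) (hl : l₂ ∈ avoidingWords231 α) :
    l₁ ∈ avoidingWords231 α :=
  ⟨mem_avoidingWords_of_sublist h hl.1, mem_avoidingWords_of_sublist h hl.2⟩

theorem cons_mem_avoidingWords231 (hx : ∀ y ∈ l, x < y) (hl : l ∈ avoidingWords231 α) :
    x :: l ∈ avoidingWords231 α := by
  obtain ⟨hl, hl231⟩ := hl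
  rw [mem_avoidingWords_forbiddenPatterns] at hl
  rw [mem_avoidingWords_231] at hl231
  refine ⟨mem_avoidingWords_forbiddenPatterns.2 fun a b c d h => ?_,
    mem_avoidingWords_231.2 fun a b c h => ?_⟩
  · rcases List.sublist_cons_iff.1 h with h | ⟨v, h_eq, h⟩
    · exact hl a b c d h
    · obtain ⟨rfl, rfl⟩ := List.cons_eq_cons.1 h_eq
      have hb := hx b (h.subset (by simp))
      have hc := hx c (h.subset (by simp))
      have h231 := hl231 b c d h
      exact ⟨fun h1342 => h231 h1342.2, fun h2143 => hb.not_gt h2143.1,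
        fun h2413 => hc.not_gt h2413.1⟩
  · rcases List.sublist_cons_iff.1 h with h | ⟨v, h_eq, h⟩
    · exact hl231 a b c h
    · obtain ⟨rfl, rfl⟩ := List.cons_eq_cons.1 h_eq
      exact fun h231 => (hx c (h.subset (by simp))).not_gt h231.1

theorem append_mem_avoidingWords231_of_pairwise {S : List α} (hS : S.Pairwise (· < ·))
    (hSl : ∀ x ∈ S, ∀ y ∈ l, x < y) (hl : l ∈ avoidingWords231 α) :
    S ++ l ∈ avoidingWords231 α := by
  induction S with
  | nil => exact hl
  | cons x S ih =>
    obtain ⟨hx, hS⟩ := List.pairwise_cons.1 hS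
    rw [List.forall_mem_cons] at hSl
    exact cons_mem_avoidingWords231 (List.forall_mem_append.2 ⟨hx, hSl.1⟩) (ih hS hSl.2)

theorem cons_mem_avoidingWords231_of_gt (hm : ∀ x ∈ l, x < m) (hl : l ∈ avoidingWords231 α) :
    m :: l ∈ avoidingWords231 α :=
  ⟨cons_mem_avoidingWords (by simp [forbiddenPatterns, Fin.exists_fin_succ]) hl.1 hm,
    cons_mem_avoidingWords (by simp [Fin.exists_fin_succ]) hl.2 hm⟩

theorem concat_mem_avoidingWords231 (hm : ∀ x ∈ l, x < m) (hl : l ∈ avoidingWords231 α) :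
    l ++ [m] ∈ avoidingWords231 α :=
  ⟨concat_mem_avoidingWords (by simp [forbiddenPatterns, Fin.exists_fin_succ]) hl.1 hm,
    concat_mem_avoidingWords (by simp [Fin.exists_fin_succ]) hl.2 hm⟩

end Closure

section Maximum

variable {α : Type*} {L R S U : List α} {m : α}

theorem exists_append_of_pairwise {p : α → Prop} {l : List α}
    (h : l.Pairwise fun a b => p b → p a) :
    ∃ l₁ l₂, l = l₁ ++ l₂ ∧ (∀ x ∈ l₁, p x) ∧ ∀ x ∈ l₂, ¬ p x := by
  induction l with
  | nil => exact ⟨[], [], by simp⟩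
  | cons a l ih =>
    obtain ⟨ha, hl⟩ := List.pairwise_cons.1 h
    by_cases hpa : p a
    · obtain ⟨l₁, l₂, rfl, h₁, h₂⟩ := ih hl
      exact ⟨a :: l₁, l₂, rfl, by simpa [hpa] using h₁, h₂⟩
    · exact ⟨[], a :: l, rfl, by simp, by simpa [hpa] using fun x hx hpx => hpa (ha x hx hpx)⟩

theorem append_inj_of_forall {p : α → Prop} {l₁ l₂ l₁' l₂' : List α}
    (h₁ : ∀ x ∈ l₁, p x) (h₂ : ∀ x ∈ l₂, ¬ p x) (h₁' : ∀ x ∈ l₁', p x) (h₂' : ∀ x ∈ l₂', ¬ p x)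
    (h : l₁ ++ l₂ = l₁' ++ l₂') : l₁ = l₁' ∧ l₂ = l₂' := by
  classical
  have h_filter := congrArg (List.filter (p ·)) h
  rw [List.filter_append, List.filter_append, List.filter_eq_self.2 (by simpa using h₁),
    List.filter_eq_nil_iff.2 (by simpa using h₂), List.filter_eq_self.2 (by simpa using h₁'),
    List.filter_eq_nil_iff.2 (by simpa using h₂'), List.append_nil, List.append_nil] at h_filter
  subst h_filter
  exact ⟨rfl, List.append_cancel_left h⟩

theorem quad_sublist_append_cons {a b d : α} (hab : [a, b] <+ L) (hd : d ∈ R) :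
    [a, b, m, d] <+ L ++ m :: R :=
  hab.append ((List.singleton_sublist.2 hd).cons_cons m)

theorem mem_avoidingWords231_of_forall_exists_lt [Preorder α]
    (h : L ++ m :: R ∈ avoidingWords α forbiddenPatterns) (hU : U <+ R)
    (hLU : ∀ y ∈ U, ∃ x ∈ L, x < y) : U ∈ avoidingWords231 α := by
  refine ⟨mem_avoidingWords_of_sublist (hU.trans (List.sublist_append_of_sublist_right
    (List.sublist_cons_self m R))) h, mem_avoidingWords_231.2 fun a b c habc hc => ?_⟩
  obtain ⟨x, hx, hxc⟩ := hLU c (habc.subset (by simp))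
  exact (mem_avoidingWords_forbiddenPatterns.1 h x a b c
    ((List.singleton_sublist.2 hx).append ((habc.trans hU).cons m))).1 ⟨hxc, hc⟩

variable [LinearOrder α]

theorem exists_left_eq_append (h : L ++ m :: R ∈ avoidingWords α forbiddenPatterns)
    (hL : ∀ x ∈ L, x < m) (hLR : L.Disjoint R) :
    ∃ B S, L = B ++ S ∧ (∀ x ∈ B, ∀ y ∈ R, y < x) ∧ ∀ x ∈ S, ∃ y ∈ R, x < y := by
  have h_pairwise : L.Pairwise fun a b => (∀ y ∈ R, y < b) → ∀ y ∈ R, y < a := by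
    refine List.pairwise_iff_forall_sublist.2 fun {a b} hab hb y hy => ?_
    have h1342 := (mem_avoidingWords_forbiddenPatterns.1 h _ _ _ _
      (quad_sublist_append_cons hab hy)).1
    have hya : y ≠ a := fun h_eq => hLR (hab.subset (by simp)) (h_eq ▸ hy)
    have hbm : b < m := hL b (hab.subset (by simp))
    exact (not_lt.1 fun hay => h1342 ⟨hay, hb y hy, hbm⟩).lt_of_ne hya
  obtain ⟨B, S, rfl, hB, hS⟩ := exists_append_of_pairwise h_pairwise
  refine ⟨B, S, rfl, hB, fun x hx => ?_⟩
  obtain ⟨y, hy, hxy⟩ : ∃ y ∈ R, x ≤ y := by simpa using hS x hx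
  exact ⟨y, hy, hxy.lt_of_ne fun h_eq => hLR (List.mem_append_right B hx) (h_eq ▸ hy)⟩

theorem pairwise_lt_of_mem_avoidingWords
    (h : L ++ m :: R ∈ avoidingWords α forbiddenPatterns) (hR : ∀ y ∈ R, y < m) (hL : L.Nodup)
    (hS : S <+ L) (hSR : ∀ x ∈ S, ∃ y ∈ R, x < y) : S.Pairwise (· < ·) := by
  refine List.pairwise_iff_forall_sublist.2 fun {a b} hab => ?_
  obtain ⟨y, hy, hay⟩ := hSR a (hab.subset (by simp))
  have h2143 := (mem_avoidingWords_forbiddenPatterns.1 h _ _ _ _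
    (quad_sublist_append_cons (hab.trans hS) hy)).2.1
  have hne : a ≠ b := by simpa using hL.sublist (hab.trans hS)
  exact (not_lt.1 fun hba => h2143 ⟨hba, hay, hR y hy⟩).lt_of_ne hne

theorem exists_right_eq_append (h : L ++ m :: R ∈ avoidingWords α forbiddenPatterns)
    (hR : ∀ y ∈ R, y < m) (hLR : L.Disjoint R) (hS : S ⊆ L) :
    ∃ U D, R = U ++ D ∧ (∀ y ∈ U, ∃ x ∈ S, x < y) ∧ ∀ x ∈ S, ∀ y ∈ D, y < x := by
  have h_pairwise : R.Pairwise fun c d => (∃ x ∈ S, x < d) → ∃ x ∈ S, x < c := by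
    refine List.pairwise_iff_forall_sublist.2 fun {c d} hcd ⟨x, hx, hxd⟩ => ⟨x, hx, ?_⟩
    have h2413 := (mem_avoidingWords_forbiddenPatterns.1 h x m c d
      ((List.singleton_sublist.2 (hS hx)).append (hcd.cons_cons m))).2.2
    have hxc : x ≠ c := fun h_eq => hLR (hS hx) (h_eq ▸ hcd.subset (by simp))
    have hdm : d < m := hR d (hcd.subset (by simp))
    exact (not_lt.1 fun hcx => h2413 ⟨hcx, hxd, hdm⟩).lt_of_ne hxc
  obtain ⟨U, D, rfl, hU, hD⟩ := exists_append_of_pairwise h_pairwise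
  refine ⟨U, D, rfl, hU, fun x hx y hy => ?_⟩
  have hyx : y ≤ x := not_lt.1 fun hxy => hD y hy ⟨x, hx, hxy⟩
  exact hyx.lt_of_ne fun h_eq => hLR (hS hx) (h_eq ▸ List.mem_append_right U hy)

theorem lt_of_mem_avoidingWords (h : L ++ m :: R ∈ avoidingWords α forbiddenPatterns)
    (hL : ∀ x ∈ L, x < m) (hLR : L.Disjoint R) (hS : S <+ L) (hS_incr : S.Pairwise (· < ·))
    {x y z : α} (hx : x ∈ S) (hy : y ∈ R) (hz : z ∈ S) (hzy : z < y) : x < y := by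
  by_contra! hyx
  replace hyx : y < x := hyx.lt_of_ne fun h_eq => hLR (hS.subset hx) (h_eq ▸ hy)
  have hzx : [z, x] <+ S := List.sublist_of_subperm_of_pairwise
    (List.subperm_of_subset (by simpa using (hzy.trans hyx).ne) (by simp [hz, hx]))
    (by simpa using hzy.trans hyx) hS_incr
  exact (mem_avoidingWords_forbiddenPatterns.1 h _ _ _ _
    (quad_sublist_append_cons (hzx.trans hS) hy)).1 ⟨hzy, hyx, hL x (hS.subset hx)⟩

end Maximum

section Decomposition

variable {α : Type*} {L R : List α} {m : α}

/-- The value blocks `D < S < U < B` of an avoider `B S m U D` with maximum `m`, in increasing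
order. The two classes of blocks separate the case `S = U = []` from the case that neither is
empty. -/
abbrev avoiderBlocks (α : Type*) [LT α] : Set (Fin 4 → List α) :=
  stackedBlocks
    ![avoidingWords α forbiddenPatterns, {[]}, {[]}, avoidingWords α forbiddenPatterns]
    ![avoidingWords α forbiddenPatterns, increasingWords α \ {[]}, avoidingWords231 α \ {[]},
      avoidingWords α forbiddenPatterns]

theorem mem_avoiderBlocks [LT α] {b : Fin 4 → List α} : b ∈ avoiderBlocks α ↔ Stacked b ∧
    b 0 ∈ avoidingWords α forbiddenPatterns ∧ b 1 ∈ increasingWords α ∧ b 2 ∈ avoidingWords231 α ∧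
      b 3 ∈ avoidingWords α forbiddenPatterns ∧ (b 1 = [] ↔ b 2 = []) := by
  have h_nil : [] ∈ avoidingWords231 α := ⟨nil_mem_avoidingWords _, nil_mem_avoidingWords _⟩
  have h_nil' : [] ∈ increasingWords α := List.Pairwise.nil
  simp only [stackedBlocks, Set.mem_ofPred_eq, Fin.forall_fin_succ, Fin.succ_zero_eq_one,
    Fin.succ_one_eq_two, Fin.reduceSucc, Matrix.cons_val_zero, Matrix.cons_val_succ,
    Set.mem_singleton_iff, Set.mem_sdiff, IsEmpty.forall_iff, and_true]
  grind

theorem stacked_four_iff [LT α] {b : Fin 4 → List α} : Stacked b ↔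
    (∀ x ∈ b 0, (∀ y ∈ b 1, x < y) ∧ (∀ y ∈ b 2, x < y) ∧ ∀ y ∈ b 3, x < y) ∧
    (∀ x ∈ b 1, (∀ y ∈ b 2, x < y) ∧ ∀ y ∈ b 3, x < y) ∧ ∀ x ∈ b 2, ∀ y ∈ b 3, x < y := by
  simp only [Stacked, Fin.forall_fin_succ, Fin.succ_zero_eq_one, Fin.succ_one_eq_two,
    Fin.reduceSucc, Fin.reduceLT, lt_self_iff_false, IsEmpty.forall_iff, forall_const]
  grind

theorem exists_avoiderBlocks [LinearOrder α]
    (h : L ++ m :: R ∈ avoidingWords α forbiddenPatterns) (h_nodup : (L ++ R).Nodup)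
    (h_lt : ∀ x ∈ L ++ R, x < m) :
    ∃ b ∈ avoiderBlocks α, L = b 3 ++ b 1 ∧ R = b 2 ++ b 0 := by
  obtain ⟨hL, -, hLR⟩ := List.nodup_append'.1 h_nodup
  obtain ⟨hLm, hRm⟩ := List.forall_mem_append.1 h_lt
  obtain ⟨B, S, rfl, hBR, hSR⟩ := exists_left_eq_append h hLm hLR
  have hS : S <+ B ++ S := List.sublist_append_right B S
  have hS_incr := pairwise_lt_of_mem_avoidingWords h hRm hL hS hSR
  obtain ⟨U, D, rfl, hSU, hSD⟩ := exists_right_eq_append h hRm hLR hS.subset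
  have hB : B ∈ avoidingWords α forbiddenPatterns := mem_avoidingWords_of_sublist (by simp) h
  have hD : D ∈ avoidingWords α forbiddenPatterns :=
    mem_avoidingWords_of_sublist
      (((U.sublist_append_right D).cons m).trans (List.sublist_append_right _ _)) h
  have hU := mem_avoidingWords231_of_forall_exists_lt h (List.sublist_append_left U D)
    fun y hy => (hSU y hy).imp fun x hx => ⟨hS.subset hx.1, hx.2⟩
  simp only [List.forall_mem_append] at hBR
  have h_lt (x) (hx : x ∈ S) (y) (hy : y ∈ U) : x < y :=
    let ⟨z, hz, hzy⟩ := hSU y hy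
    lt_of_mem_avoidingWords h hLm hLR hS hS_incr hx (List.mem_append_left D hy) hz hzy
  refine ⟨![D, S, U, B], mem_avoiderBlocks.2 ⟨stacked_four_iff.2 ⟨?_, ?_, ?_⟩, hD, hS_incr, hU, hB,
    ?_⟩, rfl, rfl⟩
  · exact fun y hy => ⟨fun x hx => hSD x hx y hy, fun z hz => let ⟨x, hx, hxz⟩ := hSU z hz
      (hSD x hx y hy).trans hxz, fun x hx => (hBR x hx).2 y hy⟩
  · exact fun x hx => ⟨h_lt x hx, fun z hz => let ⟨y, hy, hxy⟩ := hSR x hx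
      hxy.trans (List.forall_mem_append.2 (hBR z hz) y hy)⟩
  · exact fun y hy x hx => (hBR x hx).1 y hy
  · change S = [] ↔ U = []
    refine ⟨?_, ?_⟩ <;> rintro rfl <;> refine List.eq_nil_iff_forall_not_mem.2 fun x hx => ?_
    · simpa using hSU x hx
    · obtain ⟨y, hy, hxy⟩ := hSR x hx
      exact hxy.not_gt (hSD x hx y hy)

theorem mem_avoidingWords_of_mem_avoiderBlocks [Preorder α] {b : Fin 4 → List α}
    (hb : b ∈ avoiderBlocks α) (h_lt : ∀ x ∈ (b 3 ++ b 1) ++ (b 2 ++ b 0), x < m) :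
    (b 3 ++ b 1) ++ m :: (b 2 ++ b 0) ∈ avoidingWords α forbiddenPatterns := by
  obtain ⟨h_stacked, hD, hS, hU, hB, -⟩ := mem_avoiderBlocks.1 hb
  rw [stacked_four_iff] at h_stacked
  simp only [List.forall_mem_append] at h_lt
  have h_patterns : ∀ τ ∈ forbiddenPatterns,
      τ 0 < τ (Fin.last 3) ∧ ∃ j, τ (Fin.last 3) < τ j := by
    simp [forbiddenPatterns, Fin.exists_fin_succ]
  have hSU : b 1 ++ m :: b 2 ∈ avoidingWords231 α :=
    append_mem_avoidingWords231_of_pairwise hS (by grind)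
      (cons_mem_avoidingWords231_of_gt (by grind) hU)
  have hBSU : b 3 ++ (b 1 ++ m :: b 2) ∈ avoidingWords α forbiddenPatterns :=
    append_mem_avoidingWords h_patterns hB hSU.1 (m := m) (by grind) (by grind)
  have h_all := append_mem_avoidingWords h_patterns hBSU hD (m := m) (by grind) (by grind)
  simpa using h_all

theorem exists_gt_of_mem_avoiderBlocks [LT α] {b : Fin 4 → List α}
    (hb : b ∈ avoiderBlocks α) {x : α} (hx : x ∈ b 1) : ∃ y ∈ b 2, x < y := by
  obtain ⟨h_stacked, -, -, -, -, h_nil⟩ := mem_avoiderBlocks.1 hb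
  obtain ⟨y, hy⟩ := List.exists_mem_of_ne_nil _ (mt h_nil.2 (List.ne_nil_of_mem hx))
  exact ⟨y, hy, h_stacked 1 2 (by decide) x hx y hy⟩

theorem exists_lt_of_mem_avoiderBlocks [LT α] {b : Fin 4 → List α}
    (hb : b ∈ avoiderBlocks α) {y : α} (hy : y ∈ b 2) : ∃ x ∈ b 1, x < y := by
  obtain ⟨h_stacked, -, -, -, -, h_nil⟩ := mem_avoiderBlocks.1 hb
  obtain ⟨x, hx⟩ := List.exists_mem_of_ne_nil _ (mt h_nil.1 (List.ne_nil_of_mem hy))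
  exact ⟨x, hx, h_stacked 1 2 (by decide) x hx y hy⟩

theorem injOn_avoiderBlocks [Preorder α] :
    (avoiderBlocks α).InjOn fun b => (b 3 ++ b 1, b 2 ++ b 0) := by
  have h_left {b : Fin 4 → List α} (hb : b ∈ avoiderBlocks α) :
      (∀ x ∈ b 3, ∀ y ∈ b 2 ++ b 0, y < x) ∧ ∀ x ∈ b 1, ¬ ∀ y ∈ b 2 ++ b 0, y < x := by
    have h_stacked := stacked_four_iff.1 hb.1
    refine ⟨by grind, fun x hx h => ?_⟩
    obtain ⟨y, hy, hxy⟩ := exists_gt_of_mem_avoiderBlocks hb hx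
    exact hxy.not_gt (h y (List.mem_append_left _ hy))
  have h_right {b : Fin 4 → List α} (hb : b ∈ avoiderBlocks α) :
      (∀ y ∈ b 2, ∃ x ∈ b 1, x < y) ∧ ∀ y ∈ b 0, ¬ ∃ x ∈ b 1, x < y := by
    have h_stacked := stacked_four_iff.1 hb.1
    refine ⟨fun y hy => exists_lt_of_mem_avoiderBlocks hb hy, fun y hy ⟨x, hx, hxy⟩ => ?_⟩
    exact hxy.not_gt ((h_stacked.1 y hy).1 x hx)
  intro b hb b' hb' h
  obtain ⟨h₃₁, h₂₀⟩ := Prod.ext_iff.1 h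
  dsimp only at h₃₁ h₂₀
  obtain ⟨h₃, h₁⟩ := append_inj_of_forall (h_left hb).1 (h_left hb).2 (h₂₀ ▸ (h_left hb').1)
    (h₂₀ ▸ (h_left hb').2) h₃₁
  obtain ⟨h₂, h₀⟩ := append_inj_of_forall (h_right hb).1 (h_right hb).2 (h₁ ▸ (h_right hb').1)
    (h₁ ▸ (h_right hb').2) h₂₀
  ext1 i
  fin_cases i <;> assumption

end Decomposition

section Decomposition231

variable {α : Type*} {L R : List α} {m : α}

/-- The value blocks `S < U` of a word `S m U` in `avoidingWords231` with maximum `m`. If `U` is not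
empty then `S` has to increase, since a descent of `S` followed by `m` and a letter of `U` is an
occurrence of `2143`. -/
abbrev avoider231Blocks (α : Type*) [LT α] : Set (Fin 2 → List α) :=
  stackedBlocks ![avoidingWords231 α, {[]}] ![increasingWords α, avoidingWords231 α \ {[]}]

theorem mem_avoider231Blocks [LT α] {b : Fin 2 → List α} : b ∈ avoider231Blocks α ↔
    (∀ x ∈ b 0, ∀ y ∈ b 1, x < y) ∧ (b 0 ∈ avoidingWords231 α ∧ b 1 = [] ∨
      b 0 ∈ increasingWords α ∧ b 1 ∈ avoidingWords231 α ∧ b 1 ≠ []) := by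
  simp [stackedBlocks, Stacked, Fin.forall_fin_succ]

theorem exists_avoider231Blocks [LinearOrder α] (h : L ++ m :: R ∈ avoidingWords231 α)
    (h_nodup : (L ++ R).Nodup) (h_lt : ∀ x ∈ L ++ R, x < m) :
    ∃ b ∈ avoider231Blocks α, L = b 0 ∧ R = b 1 := by
  obtain ⟨hL, -, hLR⟩ := List.nodup_append'.1 h_nodup
  have hRm : ∀ y ∈ R, y < m := fun y hy => h_lt y (List.mem_append_right L hy)
  have h_lt (x) (hx : x ∈ L) (y) (hy : y ∈ R) : x < y := by
    have h231 := mem_avoidingWords_231.1 h.2 x m y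
      ((List.singleton_sublist.2 hx).append ((List.singleton_sublist.2 hy).cons_cons m))
    exact (not_lt.1 fun hyx => h231 ⟨hyx, h_lt x (List.mem_append_left R hx)⟩).lt_of_ne
      fun h_eq => hLR hx (h_eq ▸ hy)
  refine ⟨![L, R], mem_avoider231Blocks.2 ⟨h_lt, ?_⟩, rfl, rfl⟩
  rcases R.eq_nil_or_concat' with rfl | ⟨R, y, rfl⟩
  · exact .inl ⟨mem_avoidingWords231_of_sublist (List.sublist_append_left _ _) h, rfl⟩
  · refine .inr ⟨pairwise_lt_of_mem_avoidingWords h.1 hRm hL (.refl L) fun x hx => ?_,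
      mem_avoidingWords231_of_sublist (by simp) h, by simp⟩
    exact ⟨y, by simp, h_lt x hx y (by simp)⟩

theorem mem_avoidingWords231_of_mem_avoider231Blocks [Preorder α] {b : Fin 2 → List α}
    (hb : b ∈ avoider231Blocks α) (h_lt : ∀ x ∈ b 0 ++ b 1, x < m) :
    b 0 ++ m :: b 1 ∈ avoidingWords231 α := by
  rw [List.forall_mem_append] at h_lt
  obtain ⟨h_stacked, ⟨h₀, h₁⟩ | ⟨h₀, h₁, -⟩⟩ := mem_avoider231Blocks.1 hb
  · rw [h₁]
    exact concat_mem_avoidingWords231 h_lt.1 h₀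
  · exact append_mem_avoidingWords231_of_pairwise h₀
      (fun x hx => List.forall_mem_cons.2 ⟨h_lt.1 x hx, h_stacked x hx⟩)
      (cons_mem_avoidingWords231_of_gt h_lt.2 h₁)

end Decomposition231

section GeneratingFunctions

theorem append_cons_perm_range'_iff {n : ℕ} {L R : List ℕ} :
    L ++ n :: R ~ List.range' 0 (n + 1) ↔ L ++ R ~ List.range' 0 n := by
  have h_concat := List.perm_append_singleton n (List.range' 0 n)
  rw [List.range'_1_concat, zero_add]
  exact ⟨fun h => (List.perm_cons n).1 ((List.perm_middle.symm.trans h).trans h_concat),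
    fun h => List.perm_middle.trans ((h.cons n).trans h_concat.symm)⟩

variable {k : ℕ} {C : Set (List ℕ)} {P Q : Fin k → Set (List ℕ)}
    {split : (Fin k → List ℕ) → List ℕ × List ℕ}

theorem stackings_union_stackings (s n : ℕ) : stackings P s n ∪ stackings Q s n =
    {b ∈ stackedBlocks P Q | (List.ofFn b).flatten ~ List.range' s n} := by
  ext b
  simp only [stackings, stackedBlocks, Set.mem_union, Set.mem_ofPred_eq]
  tauto

theorem bijOn_stackings (h_perm : ∀ b, (split b).1 ++ (split b).2 ~ (List.ofFn b).flatten)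
    (h_inj : (stackedBlocks P Q).InjOn split)
    (h_mem : ∀ m, ∀ b ∈ stackedBlocks P Q, (∀ x ∈ (split b).1 ++ (split b).2, x < m) →
      (split b).1 ++ m :: (split b).2 ∈ C)
    (h_exists : ∀ L m R, L ++ m :: R ∈ C → (L ++ R).Nodup → (∀ x ∈ L ++ R, x < m) →
      ∃ b ∈ stackedBlocks P Q, split b = (L, R)) (n : ℕ) :
    Set.BijOn (fun b => (split b).1 ++ n :: (split b).2) (stackings P 0 n ∪ stackings Q 0 n)
      (words C 0 (n + 1)) := by
  have h_range {l : List ℕ} (hl : l ~ List.range' 0 n) : l.Nodup ∧ ∀ x ∈ l, x < n :=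
    ⟨hl.nodup_iff.2 List.nodup_range', fun x hx => by simpa using hl.mem_iff.1 hx⟩
  rw [stackings_union_stackings]
  refine ⟨?_, ?_, ?_⟩
  · rintro b ⟨hb, hbn⟩
    have hbn := (h_perm b).trans hbn
    exact ⟨h_mem n b hb (h_range hbn).2, append_cons_perm_range'_iff.2 hbn⟩
  · rintro b ⟨hb, hbn⟩ b' ⟨hb', -⟩ h_eq
    have h_notMem : n ∉ (split b).1 ++ (split b).2 :=
      fun h => ((h_range ((h_perm b).trans hbn)).2 n h).false
    rw [List.mem_append, not_or] at h_notMem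
    obtain ⟨h_fst, -, h_snd⟩ := (List.append_cons_inj_of_notMem h_notMem.1 h_notMem.2).1 h_eq
    exact h_inj hb hb' (Prod.ext h_fst h_snd)
  · rintro l ⟨hl, hln⟩
    obtain ⟨L, R, rfl⟩ := List.append_of_mem (hln.mem_iff.2 (by simp : n ∈ _))
    have hLR := append_cons_perm_range'_iff.1 hln
    obtain ⟨b, hb, h_split⟩ := h_exists L n R hl (h_range hLR).1 (h_range hLR).2
    refine ⟨b, ⟨hb, (h_perm b).symm.trans ?_⟩, ?_⟩
    · rwa [h_split]
    · simp only [h_split]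

theorem wordGF_avoidingWords231 : wordGF (avoidingWords231 ℕ) = 1 + X *
    (wordGF (avoidingWords231 ℕ) + PowerSeries.mk 1 * (wordGF (avoidingWords231 ℕ) - 1)) := by
  have h_nil : [] ∈ avoidingWords231 ℕ := ⟨nil_mem_avoidingWords _, nil_mem_avoidingWords _⟩
  have hG : TranslationInvariant (avoidingWords231 ℕ) :=
    (translationInvariant_avoidingWords _).inter (translationInvariant_avoidingWords _)
  have h_bijOn := bijOn_stackings (C := avoidingWords231 ℕ) (split := fun b => (b 0, b 1))
    (fun b => by simp [List.ofFn_succ])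
    (fun b _ b' _ h => by ext1 i; fin_cases i; exacts [congrArg Prod.fst h, congrArg Prod.snd h])
    (fun m b hb h_lt => mem_avoidingWords231_of_mem_avoider231Blocks hb h_lt)
    (fun L m R h h_nodup h_lt => by
      obtain ⟨b, hb, rfl, rfl⟩ := exists_avoider231Blocks h h_nodup h_lt
      exact ⟨b, hb, rfl⟩)
  have h_gf := wordGF_eq_one_add_X_mul h_nil
    (Fin.forall_fin_two.2 ⟨hG, translationInvariant_singleton_nil⟩)
    (Fin.forall_fin_two.2 ⟨translationInvariant_increasingWords,
      hG.diff translationInvariant_singleton_nil⟩)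
    ⟨1, disjoint_sdiff_self_right⟩ h_bijOn
  simpa only [Fin.prod_univ_two, Matrix.cons_val_zero, Matrix.cons_val_one, mul_one,
    wordGF_singleton_nil, wordGF_increasingWords, wordGF_diff_singleton_nil h_nil] using h_gf

theorem mul_wordGF_avoidingWords231_sub_one :
    (1 - 3 * X + X ^ 2) * (wordGF (avoidingWords231 ℕ) - 1) = X * (1 - X) := by
  linear_combination (1 - X) * wordGF_avoidingWords231 +
    X * (wordGF (avoidingWords231 ℕ) - 1) * PowerSeries.mk_one_mul_one_sub_eq_one ℚ

theorem wordGF_avoidingWords_forbiddenPatterns :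
    wordGF (avoidingWords ℕ forbiddenPatterns) = 1 + X *
      (wordGF (avoidingWords ℕ forbiddenPatterns) ^ 2 *
        (1 + (PowerSeries.mk 1 - 1) * (wordGF (avoidingWords231 ℕ) - 1))) := by
  have h_nil : [] ∈ avoidingWords231 ℕ := ⟨nil_mem_avoidingWords _, nil_mem_avoidingWords _⟩
  have h_nil' : [] ∈ increasingWords ℕ := List.Pairwise.nil
  have hF := translationInvariant_avoidingWords forbiddenPatterns
  have hG : TranslationInvariant (avoidingWords231 ℕ) :=
    hF.inter (translationInvariant_avoidingWords _)
  have h_perm (b : Fin 4 → List ℕ) :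
      (b 3 ++ b 1) ++ (b 2 ++ b 0) ~ (List.ofFn b).flatten := by
    rw [List.perm_iff_count]
    intro x
    simp only [List.ofFn_succ, List.ofFn_zero, List.flatten_cons, List.flatten_nil,
      List.count_append, List.count_nil, Fin.succ_zero_eq_one, Fin.succ_one_eq_two, Fin.reduceSucc]
    lia
  have h_bijOn := bijOn_stackings (C := avoidingWords ℕ forbiddenPatterns)
    (split := fun b => (b 3 ++ b 1, b 2 ++ b 0)) h_perm injOn_avoiderBlocks
    (fun m b hb h_lt => mem_avoidingWords_of_mem_avoiderBlocks hb h_lt)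
    (fun L m R h h_nodup h_lt => by
      obtain ⟨b, hb, rfl, rfl⟩ := exists_avoiderBlocks h h_nodup h_lt
      exact ⟨b, hb, rfl⟩)
  have h_gf := wordGF_eq_one_add_X_mul (nil_mem_avoidingWords _)
    (by simp [Fin.forall_fin_succ, hF, translationInvariant_singleton_nil])
    (by simp [Fin.forall_fin_succ, hF, hG.diff translationInvariant_singleton_nil,
      translationInvariant_increasingWords.diff translationInvariant_singleton_nil])
    ⟨1, disjoint_sdiff_self_right⟩ h_bijOn
  simp only [Fin.prod_univ_four, Matrix.cons_val, mul_one, wordGF_singleton_nil,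
    wordGF_increasingWords, wordGF_diff_singleton_nil h_nil,
    wordGF_diff_singleton_nil h_nil'] at h_gf
  linear_combination h_gf

theorem avoiderGF_forbiddenPatterns_quadratic :
    (1 - 3 * X + X ^ 2) * avoiderGF forbiddenPatterns = 1 - 3 * X + X ^ 2 +
      X * (1 - X) * (1 - 2 * X) * avoiderGF forbiddenPatterns ^ 2 := by
  rw [avoiderGF_eq_wordGF]
  linear_combination (1 - 3 * X + X ^ 2) * wordGF_avoidingWords_forbiddenPatterns +
    X * wordGF (avoidingWords ℕ forbiddenPatterns) ^ 2 * (PowerSeries.mk 1 - 1) *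
      mul_wordGF_avoidingWords231_sub_one +
    X * wordGF (avoidingWords ℕ forbiddenPatterns) ^ 2 * X *
      PowerSeries.mk_one_mul_one_sub_eq_one ℚ

end GeneratingFunctions

theorem coe_laurentSeries_eq_div {R : Type*} [Field R] {f g h : R⟦X⟧} (hg : g ≠ 0)
    (h_eq : g * f = h) :
    (f : LaurentSeries R) = (h : LaurentSeries R) / (g : LaurentSeries R) := by
  have hg' : (g : LaurentSeries R) ≠ 0 := fun h₀ =>
    hg (HahnSeries.ofPowerSeries_injective (h₀.trans (map_zero _).symm))
  rw [eq_div_iff hg', mul_comm, ← PowerSeries.coe_mul, h_eq]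

theorem mainTheorem11 :
    ∃ R : ℚ⟦X⟧,
      R ^ 2 = (1 - 7 * X + 13 * X ^ 2 - 8 * X ^ 3) * (1 - 3 * X + X ^ 2) ∧
      PowerSeries.constantCoeff R = 1 ∧
      ((avoiderGF {![1, 3, 4, 2], ![2, 1, 4, 3], ![2, 4, 1, 3]} : ℚ⟦X⟧) : LaurentSeries ℚ) =
        ((1 - 3 * X + X ^ 2 - R : ℚ⟦X⟧) : LaurentSeries ℚ) /
          ((2 * X * (1 - X) * (1 - 2 * X) : ℚ⟦X⟧) : LaurentSeries ℚ) := by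
  change ∃ R : ℚ⟦X⟧, _ ∧ _ ∧ (avoiderGF forbiddenPatterns : LaurentSeries ℚ) = _
  have h_denominator : 2 * X * (1 - X) * (1 - 2 * X) ≠ (0 : ℚ⟦X⟧) := by
    have h_ne {f : ℚ⟦X⟧} : constantCoeff f ≠ 0 → f ≠ 0 := mt fun h => by rw [h, map_zero]
    exact mul_ne_zero (mul_ne_zero (mul_ne_zero (h_ne ((map_ofNat _ 2).trans_ne two_ne_zero))
      X_ne_zero) (h_ne (by simp))) (h_ne (by simp))
  refine ⟨1 - 3 * X + X ^ 2 - 2 * X * (1 - X) * (1 - 2 * X) * avoiderGF forbiddenPatterns, ?_,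
    by simp, coe_laurentSeries_eq_div h_denominator (by ring)⟩
  linear_combination
    (-4 * (X * (1 - X) * (1 - 2 * X))) * avoiderGF_forbiddenPatterns_quadratic
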